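/- Let $\mathcal{A}=\{1<2<3<\cdots\}$ and let $\mathcal{A}^*$ be the free monoid of words over $\mathcal{A}$. For $i\ge 1$, the quasi-Kashiwara operator $f_i$ is the partial map on $\mathcal{A}^*$ such that $f_i(u)$ is undefined if some letter $i+1$ of $u$ stands to the left of some letter $i$ of $u$, or if $u$ contains no $i$; otherwise $f_i(u)$ is obtained from $u$ by replacing the right-most $i$ by $i+1$. The quasi-crystal graph $\Gamma(\mathsf{hypo})$ is the labelled directed graph with vertex set $\mathcal{A}^*$ and an edge $u\to v$ with label $i$ if and only if $v=f_i(u)$. Let $\Gamma(\mathsf{hypo},u)$ be the connected component of $u$ (directions of edges being ignored). For $u\in\mathcal{A}^*$, let $\mathrm{std}(u)$ be its standardization (letters are ranked by value, equal letters from left to right), viewed as a permutation. For a word without repeated letters, its decreasing tree is empty if the word is empty; if the word is $s\,m\,s'$ with $m$ its largest letter, then the tree has root $m$, left subtree the decreasing tree of $s$, and right subtree the decreasing tree of $s'$. Let $\sigma_{\mathsf{sylv}}(u)$ be the shape (underlying unlabelled binary tree) of the decreasing tree of the word $\mathrm{std}(u)^{-1}$. Write $u\sim_{\mathsf{sylv}}v$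 if there is an isomorphism of labelled directed graphs $\theta:\Gamma(\mathsf{hypo},u)\to\Gamma(\mathsf{hypo},v)$ such that $\theta(u)=v$ and $\sigma_{\mathsf{sylv}}(\theta(w))=\sigma_{\mathsf{sylv}}(w)$ for all vertices $w$ of $\Gamma(\mathsf{hypo},u)$. Let $\mathrm{P}_{\mathsf{sylv}}(u)$ be the right strict binary search tree obtained from the empty tree by inserting the letters of $u$ from right to left, where a letter $a$ is inserted into the empty tree by creating a node $a$, and into a tree with root $x$ by inserting it recursively into the left subtree if $a\le x$ and into the right subtree if $a>x$. Write $u\equiv_{\mathsf{sylv}}v$ if $\mathrm{P}_{\mathsf{sylv}}(u)=\mathrm{P}_{\mathsf{sylv}}(v)$. **Proposition.** The relations $\sim_{\mathsf{sylv}}$ and $\equiv_{\mathsf{sylv}}$ are congruences on $\mathcal{A}^*$, and they coincide. Hence $\mathcal{A}^*/{\sim_{\mathsf{sylv}}}$ is the sylvester monoid $\mathcal{A}^*/{\equiv_{\mathsf{sylv}}}$. -/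

import Mathlib

namespace SylvQC

/-! ## Words over the infinite ordered alphabet `1 < 2 < 3 < ⋯` and the quasi-crystal graph -/

/-- Words over the alphabet `{1 < 2 < 3 < ⋯}`; the empty word is `[]`. -/
abbrev Word : Type := List ℕ+

/-- The quasi-Kashiwara lowering operator `f_i`, with `none` for "undefined".
It is undefined if `i + 1` occurs somewhere to the left of an `i`, or if `i` does not occur;
otherwise it replaces the right-most `i` by `i + 1`. -/
def lower (i : ℕ+) (u : Word) : Option Word :=
  if List.Sublist [i + 1, i] u then none
  else if i ∈ u then some ((u.reverse.replace i (i + 1)).reverse)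
  else none

/-- `Edge i u v`: the quasi-crystal graph has an edge from `u` to `v` with label `i`. -/
def Edge (i : ℕ+) (u v : Word) : Prop := lower i u = some v

/-- Two words lie in the same connected component of the quasi-crystal graph
(directions of edges are ignored). -/
def Connected (u v : Word) : Prop := Relation.EqvGen (fun x y => ∃ i, Edge i x y) u v

/-- The (vertex set of the) connected component of `u` in the quasi-crystal graph. -/
def Component (u : Word) : Type := {w : Word // Connected u w}

/-- The word `u` as a vertex of its own component. -/
def Component.base (u : Word) : Component u := ⟨u, Relation.EqvGen.refl u⟩

/-- Quasi-crystal isomorphisms between components: isomorphisms of labelled digraphs. -/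
structure ComponentIso (u v : Word) where
  toEquiv : Component u ≃ Component v
  edge_iff : ∀ (i : ℕ+) (x y : Component u),
    Edge i x.1 y.1 ↔ Edge i (toEquiv x).1 (toEquiv y).1

/-- The isomorphism `θ` preserves `σ`. -/
def ShapePreserving {S : Type*} (σ : Word → S) {u v : Word} (θ : ComponentIso u v) : Prop :=
  ∀ w : Component u, σ (θ.toEquiv w).1 = σ w.1

/-- The relation `∼_σ`: there is a `σ`-preserving quasi-crystal isomorphism from the component
of `u` to the component of `v` that sends `u` to `v`. -/
def ShapeSim {S : Type*} (σ : Word → S) (u v : Word) : Prop :=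
  ∃ θ : ComponentIso u v, ShapePreserving σ θ ∧ θ.toEquiv (Component.base u) = Component.base v

/-! ## Standardization -/

/-- The (0-based) rank of the `p`-th letter of `u` when the letters are ordered by value and
equal letters are ordered from left to right. -/
def rank (u : Word) (p : Fin u.length) : ℕ :=
  (Finset.univ.filter
    (fun q : Fin u.length => u.get q < u.get p ∨ (u.get q = u.get p ∧ q < p))).card

theorem rank_lt (u : Word) (p : Fin u.length) : rank u p < u.length := by
  have h : (Finset.univ.filter
      (fun q : Fin u.length => u.get q < u.get p ∨ (u.get q = u.get p ∧ q < p))) ⊂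
      Finset.univ := by
    refine Finset.ssubset_univ_iff.2 (fun h => ?_)
    have := (Finset.mem_filter.1 (h ▸ Finset.mem_univ p)).2
    simp at this
  simpa [rank] using Finset.card_lt_card h

theorem rank_lt_rank (u : Word) {p q : Fin u.length}
    (h : u.get p < u.get q ∨ (u.get p = u.get q ∧ p < q)) : rank u p < rank u q := by
  refine Finset.card_lt_card (Finset.ssubset_iff_subset_ne.2 ⟨fun r hr => ?_, fun he => ?_⟩)
  · simp only [Finset.mem_filter, Finset.mem_univ, true_and] at hr ⊢
    rcases hr with hr | ⟨hr, hr'⟩ <;> rcases h with h | ⟨h, h'⟩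
    · exact Or.inl (hr.trans h)
    · exact Or.inl (h ▸ hr)
    · exact Or.inl (hr ▸ h)
    · exact Or.inr ⟨hr.trans h, hr'.trans h'⟩
  · have hp : p ∈ Finset.univ.filter
        (fun r : Fin u.length => u.get r < u.get p ∨ (u.get r = u.get p ∧ r < p)) := by
      rw [he]
      simpa using h
    simp at hp

theorem rank_injective (u : Word) :
    Function.Injective (fun p : Fin u.length => (⟨rank u p, rank_lt u p⟩ : Fin u.length)) := by
  intro p q h
  have h' : rank u p = rank u q := congrArg Fin.val h
  by_contra hne
  rcases lt_trichotomy (u.get p) (u.get q) with hl | he | hl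
  · exact absurd h' (rank_lt_rank u (Or.inl hl)).ne
  · rcases lt_or_gt_of_ne hne with hl | hl
    · exact absurd h' (rank_lt_rank u (Or.inr ⟨he, hl⟩)).ne
    · exact absurd h' (rank_lt_rank u (Or.inr ⟨he.symm, hl⟩)).ne'
  · exact absurd h' (rank_lt_rank u (Or.inl hl)).ne'

/-- The standardization `std(u)`, as a permutation of the (0-based) positions of `u`. -/
noncomputable def stdPerm (u : Word) : Equiv.Perm (Fin u.length) :=
  Equiv.ofBijective _ (Finite.injective_iff_bijective.1 (rank_injective u))

/-- The standard word `σ(1) σ(2) ⋯ σ(n)` of a permutation `σ` (one-line notation). -/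
def oneLine {n : ℕ} (σ : Equiv.Perm (Fin n)) : Word :=
  List.ofFn (fun p => Nat.succPNat (σ p))

/-! ## Binary trees -/

/-- The decreasing tree of a word without repeated letters: if the word is `s m s'` with `m` the
maximum letter, the root is labelled by `m`, and its left and right subtrees are the decreasing
trees of `s` and `s'`. -/
def decTree (u : Word) : BinaryTree ℕ+ :=
  match h : u.max? with
  | none => BinaryTree.nil
  | some m =>
    BinaryTree.node m (decTree (u.take (u.idxOf m))) (decTree (u.drop (u.idxOf m + 1)))
termination_by u.length
decreasing_by
  all_goals
    have hm : m ∈ u := List.max?_mem h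
    have hlt := List.idxOf_lt_length_iff.2 hm
    simp only [List.length_take, List.length_drop]
    omega

/-- The shape of a labelled binary tree: the underlying unlabelled rooted binary tree. -/
def treeShape (T : BinaryTree ℕ+) : BinaryTree Unit := T.map (fun _ => ())

/-- `σ_sylv(u)`: the shape of the decreasing tree of `std(u)⁻¹`. -/
noncomputable def sylvShape (u : Word) : BinaryTree Unit :=
  treeShape (decTree (oneLine (stdPerm u)⁻¹))

/-- Right strict leaf insertion of a letter into a binary search tree. -/
def rightInsert (a : ℕ+) : BinaryTree ℕ+ → BinaryTree ℕ+
  | BinaryTree.nil => BinaryTree.node a BinaryTree.nil BinaryTree.nil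
  | BinaryTree.node x l r =>
    if a ≤ x then BinaryTree.node x (rightInsert a l) r
    else BinaryTree.node x l (rightInsert a r)

/-- The sylvester P-symbol of `u`: the right strict binary search tree obtained from the empty
tree by inserting the letters of `u` from right to left. -/
def sylvP (u : Word) : BinaryTree ℕ+ := u.foldr rightInsert BinaryTree.nil

/-! ## The two relations -/

/-- The relation `∼_sylv` that comes from the quasi-crystal graph. -/
def CrystalSylv (u v : Word) : Prop := ShapeSim sylvShape u v

/-- The relation `≡_sylv`: the kernel of right strict binary search tree insertion. -/
def InsertionSylv (u v : Word) : Prop := sylvP u = sylvP v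

end SylvQC

/-!
The bridge between the two relations is that the insertion tree `sylvP u` carries the same data as
the pair consisting of the shape `sylvShape u` and the content of `u`. By `sylvShape_eq` the tree
`sylvP u` has shape `sylvShape u`, and by `sylvP_eq_of_treeShape_eq` a right strict binary search
tree is determined by its shape and its multiset of labels. Most arguments are inductions along
the recursion `sylvP_concat`: the last letter `x` of a word is the root, and the subtrees are the
insertion trees of the subwords of letters `≤ x` and `> x`.

Insertion equivalence is a congruence because inserting a word `u` into a tree splits `u` at the
root label, and the insertion trees of the two parts are determined by the insertion tree of `u`
(`foldr_rightInsert_congr`).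

An edge of the quasi-crystal graph preserves the standardization, hence the shape, and a word is
determined by its standardization and its content; so a component meets each insertion class at
most once (`Connected.eq_of_sylvP_eq`). Whether an edge with label `i` enters or leaves `u` depends
only on the content of `u` and on whether some `i + 1` stands to the left of some `i`, which the
insertion tree determines (`pair_sublist_iff_of_sylvP_eq`). Therefore paths lift along insertion
equivalence, and sending each vertex to the insertion-equivalent one is an isomorphism between the
components of insertion-equivalent words (`crystalSylv_of_sylvP_eq`).

Conversely, a shape-preserving isomorphism sends each vertex to an insertion-equivalent one
(`sylvP_toEquiv_eq`). Moving backwards along edges reduces this to vertices without incoming edges,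
and there the labels of the insertion tree are forced by its shape (`IsSourceFrom.sylvP_eq`).
-/

namespace SylvQC

/-! ### The insertion tree of a word -/

/-- Inserting a word into a nonempty tree splits the word at the root label. -/
theorem foldr_rightInsert_node (u : Word) (y : ℕ+) (l r : BinaryTree ℕ+) :
    u.foldr rightInsert (.node y l r) =
      .node y ((u.filter (· ≤ y)).foldr rightInsert l)
        ((u.filter (y < ·)).foldr rightInsert r) := by
  induction u with
  | nil => rfl
  | cons a u ih =>
    rw [List.foldr_cons, ih, rightInsert]
    by_cases h : a ≤ y
    · simp [h, not_lt.2 h]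
    · simp [h, not_le.1 h]

@[simp] theorem sylvP_nil : sylvP [] = .nil := rfl

/-- The last letter of a word is the root of its insertion tree, and the two subtrees are
insertion trees of subwords. -/
theorem sylvP_concat (u : Word) (x : ℕ+) :
    sylvP (u ++ [x]) = .node x (sylvP (u.filter (· ≤ x))) (sylvP (u.filter (x < ·))) := by
  simp only [sylvP, List.foldr_append, List.foldr_cons, List.foldr_nil]
  exact foldr_rightInsert_node u x .nil .nil

/-- Induction on words along the recursive structure of the insertion tree. -/
theorem word_induction {motive : Word → Prop} (nil : motive [])
    (concat : ∀ u x, motive (u.filter (· ≤ x)) → motive (u.filter (x < ·)) → motive (u ++ [x]))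
    (u : Word) : motive u := by
  induction hn : u.length using Nat.strong_induction_on generalizing u with
  | _ n ih =>
    rcases List.eq_nil_or_concat' u with rfl | ⟨u, x, rfl⟩
    · exact nil
    · simp only [List.length_append, List.length_singleton] at hn ⊢
      exact concat u x (ih _ (by have := List.length_filter_le (· ≤ x) u; omega) _ rfl)
        (ih _ (by have := List.length_filter_le (x < ·) u; omega) _ rfl)

/-- Two words have the same insertion tree exactly if both are empty, or they have the same last
letter and the corresponding subwords have the same insertion trees. This is the elimination form
for equality of insertion trees. -/
theorem sylvP_rec {motive : (u v : Word) → sylvP u = sylvP v → Prop} (nil : motive [] [] rfl)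
    (concat : ∀ (u v : Word) (x : ℕ+)
      (h₁ : sylvP (u.filter (· ≤ x)) = sylvP (v.filter (· ≤ x)))
      (h₂ : sylvP (u.filter (x < ·)) = sylvP (v.filter (x < ·))),
      motive _ _ h₁ → motive _ _ h₂ → ∀ h, motive (u ++ [x]) (v ++ [x]) h)
    {u v : Word} (h : sylvP u = sylvP v) : motive u v h := by
  induction u using word_induction generalizing v with
  | nil =>
    rcases List.eq_nil_or_concat' v with rfl | ⟨v, y, rfl⟩
    · exact nil
    · simp [sylvP_concat] at h
  | concat u x ihl ihr =>
    rcases List.eq_nil_or_concat' v with rfl | ⟨v, y, rfl⟩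
    · simp [sylvP_concat] at h
    · have h' := h
      simp only [sylvP_concat, BinaryTree.node.injEq] at h'
      obtain ⟨rfl, hl, hr⟩ := h'
      exact concat u v x hl hr (ihl hl) (ihr hr) h

/-- Induction for a pair of words whose insertion trees have the same shape. -/
theorem treeShape_sylvP_rec
    {motive : (u v : Word) → treeShape (sylvP u) = treeShape (sylvP v) → Prop}
    (nil : motive [] [] rfl)
    (concat : ∀ (u v : Word) (x y : ℕ+)
      (h₁ : treeShape (sylvP (u.filter (· ≤ x))) = treeShape (sylvP (v.filter (· ≤ y))))
      (h₂ : treeShape (sylvP (u.filter (x < ·))) = treeShape (sylvP (v.filter (y < ·)))),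
      motive _ _ h₁ → motive _ _ h₂ → ∀ h, motive (u ++ [x]) (v ++ [y]) h)
    {u v : Word} (h : treeShape (sylvP u) = treeShape (sylvP v)) : motive u v h := by
  induction u using word_induction generalizing v with
  | nil =>
    rcases List.eq_nil_or_concat' v with rfl | ⟨v, y, rfl⟩
    · exact nil
    · simp [sylvP_concat, treeShape, BinaryTree.map] at h
  | concat u x ihl ihr =>
    rcases List.eq_nil_or_concat' v with rfl | ⟨v, y, rfl⟩
    · simp [sylvP_concat, treeShape, BinaryTree.map] at h
    · have h' := h
      simp only [sylvP_concat, treeShape, BinaryTree.map,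
        BinaryTree.node.injEq, true_and] at h'
      exact concat u v x y h'.1 h'.2 (ihl h'.1) (ihr h'.2) h

theorem filter_le_append_filter_lt_perm (u : Word) (x : ℕ+) :
    (u.filter (· ≤ x) ++ u.filter (x < ·)).Perm u := by
  have h := List.filter_append_perm (fun a => decide (a ≤ x)) u
  simpa only [← decide_not, not_le] using h

theorem perm_of_sylvP_eq {u v : Word} (h : sylvP u = sylvP v) : u.Perm v := by
  induction h using sylvP_rec with
  | nil => exact .nil
  | concat u v x _ _ hl hr _ =>
    exact (((filter_le_append_filter_lt_perm u x).symm.trans (hl.append hr)).trans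
      (filter_le_append_filter_lt_perm v x)).append_right [x]

theorem length_eq_of_treeShape_eq {u v : Word}
    (h : treeShape (sylvP u) = treeShape (sylvP v)) : u.length = v.length := by
  induction h using treeShape_sylvP_rec with
  | nil => rfl
  | concat u v x y _ _ hl hr _ =>
    have hu := (filter_le_append_filter_lt_perm u x).length_eq
    have hv := (filter_le_append_filter_lt_perm v y).length_eq
    simp only [List.length_append, List.length_singleton] at hu hv ⊢
    omega

/-- In a word `v ++ [y]`, a smaller letter `x` bounds strictly fewer letters than `y` does. -/
theorem length_filter_le_lt {v : Word} {x y : ℕ+} (h : x < y) :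
    ((v ++ [y]).filter (· ≤ x)).length < ((v ++ [y]).filter (· ≤ y)).length := by
  have := (List.monotone_filter_right v (p := (· ≤ x)) (q := (· ≤ y))
    (fun a ha => by simp only [decide_eq_true_eq] at ha ⊢; exact ha.trans h.le)).length_le
  simp [not_le.2 h]
  omega

/-- A right strict binary search tree is determined by its shape and its multiset of labels. -/
theorem sylvP_eq_of_treeShape_eq {u v : Word}
    (h : treeShape (sylvP u) = treeShape (sylvP v)) (hp : u.Perm v) : sylvP u = sylvP v := by
  induction h using treeShape_sylvP_rec with
  | nil => rfl
  | concat u v x y hsh _ hl hr _ =>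
    -- The size of the left subtree gives the rank of the root label.
    have hlen := length_eq_of_treeShape_eq hsh
    have hx := (hp.filter (· ≤ x)).length_eq
    have hy := (hp.filter (· ≤ y)).length_eq
    have hu : ((u ++ [x]).filter (· ≤ x)).length = (u.filter (· ≤ x)).length + 1 := by simp
    have hv : ((v ++ [y]).filter (· ≤ y)).length = (v.filter (· ≤ y)).length + 1 := by simp
    obtain rfl : x = y := by
      rcases lt_trichotomy x y with hlt | he | hlt
      · have := length_filter_le_lt (v := v) hlt
        omega
      · exact he
      · have := length_filter_le_lt (v := u) hlt
        omega
    rw [List.perm_append_right_iff] at hp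
    rw [sylvP_concat, sylvP_concat, hl (hp.filter _), hr (hp.filter _)]

/-! ### Insertion equivalence is a congruence -/

/-- The insertion tree of the letters `≤ y` is determined by the insertion tree. -/
theorem sylvP_filter_le_congr {u v : Word} (h : sylvP u = sylvP v) (y : ℕ+) :
    sylvP (u.filter (· ≤ y)) = sylvP (v.filter (· ≤ y)) := by
  induction h using sylvP_rec with
  | nil => rfl
  | concat u v x h₁ h₂ hl hr _ =>
    by_cases hx : x ≤ y
    · have key (w : Word) : sylvP ((w ++ [x]).filter (· ≤ y)) =
          .node x (sylvP (w.filter (· ≤ x))) (sylvP ((w.filter (x < ·)).filter (· ≤ y))) := by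
        simp only [List.filter_append, List.filter_singleton, hx, decide_true, cond_true,
          sylvP_concat, List.filter_filter]
        congr 2
        · refine List.filter_congr fun a _ => ?_
          by_cases ha : a ≤ x <;> simp [ha]
          exact ha.trans hx
        · simp only [Bool.and_comm]
      rw [key, key, h₁, hr]
    · have key (w : Word) : (w ++ [x]).filter (· ≤ y) = (w.filter (· ≤ x)).filter (· ≤ y) := by
        simp only [List.filter_append, List.filter_singleton, hx, decide_false,
          cond_false, List.append_nil, List.filter_filter]
        refine List.filter_congr fun a _ => ?_
        by_cases ha : a ≤ y <;> simp [ha]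
        exact ha.trans (not_le.1 hx).le
      rw [key, key, hl]

/-- The insertion tree of the letters `> y` is determined by the insertion tree. -/
theorem sylvP_filter_lt_congr {u v : Word} (h : sylvP u = sylvP v) (y : ℕ+) :
    sylvP (u.filter (y < ·)) = sylvP (v.filter (y < ·)) := by
  induction h using sylvP_rec with
  | nil => rfl
  | concat u v x h₁ h₂ hl hr _ =>
    by_cases hx : y < x
    · have key (w : Word) : sylvP ((w ++ [x]).filter (y < ·)) =
          .node x (sylvP ((w.filter (· ≤ x)).filter (y < ·))) (sylvP (w.filter (x < ·))) := by
        simp only [List.filter_append, List.filter_singleton, hx, decide_true, cond_true,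
          sylvP_concat, List.filter_filter]
        congr 2
        · simp only [Bool.and_comm]
        · refine List.filter_congr fun a _ => ?_
          by_cases ha : x < a <;> simp [ha]
          exact hx.trans ha
      rw [key, key, h₂, hl]
    · have key (w : Word) : (w ++ [x]).filter (y < ·) = (w.filter (x < ·)).filter (y < ·) := by
        simp only [List.filter_append, List.filter_singleton, hx, decide_false,
          cond_false, List.append_nil, List.filter_filter]
        refine List.filter_congr fun a _ => ?_
        by_cases ha : y < a <;> simp [ha]
        exact (not_lt.1 hx).trans_lt ha
      rw [key, key, hr]

/-- The result of inserting a word into any tree depends only on the insertion tree of the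
word. -/
theorem foldr_rightInsert_congr {u v : Word} (h : sylvP u = sylvP v) (T : BinaryTree ℕ+) :
    u.foldr rightInsert T = v.foldr rightInsert T := by
  induction T generalizing u v with
  | nil => exact h
  | node y l r hl hr =>
    rw [foldr_rightInsert_node, foldr_rightInsert_node, hl (sylvP_filter_le_congr h y),
      hr (sylvP_filter_lt_congr h y)]

/-- Insertion equivalence as a congruence on the free monoid. -/
def insertionCon : Con (FreeMonoid ℕ+) where
  r u v := InsertionSylv u.toList v.toList
  iseqv := ⟨fun _ => rfl, fun h => Eq.symm h, fun h h' => Eq.trans h h'⟩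
  mul' {u u' v v'} h h' := by
    change sylvP _ = sylvP _ at h h' ⊢
    simp only [FreeMonoid.toList_mul, sylvP, List.foldr_append]
    rw [show List.foldr rightInsert _ v.toList = sylvP v'.toList from h']
    exact foldr_rightInsert_congr h _

/-! ### The shape of the insertion tree via standardization -/

theorem decTree_nil : decTree [] = .nil := by
  rw [decTree]
  rfl

theorem decTree_append_cons {s t : Word} {m : ℕ+} (hs : ∀ x ∈ s, x < m) (ht : ∀ x ∈ t, x < m) :
    decTree (s ++ m :: t) = .node m (decTree s) (decTree t) := by
  have hmax : (s ++ m :: t).max? = some m := by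
    rw [List.max?_eq_some_iff]
    refine ⟨by simp, fun b hb => ?_⟩
    simp only [List.mem_append, List.mem_cons] at hb
    rcases hb with hb | rfl | hb
    · exact (hs b hb).le
    · exact le_rfl
    · exact (ht b hb).le
  have hidx : (s ++ m :: t).idxOf m = s.length := by
    rw [List.idxOf_append_of_notMem (fun h => (hs m h).false)]
    simp
  rw [decTree]
  split
  · simp_all
  · rename_i m' h'
    obtain rfl : m' = m := by simpa [hmax] using h'.symm
    rw [hidx]
    simp

/-- Let `L` list pairs (letter, position) by increasing position, and let `S` list them by letter
and then position. The decreasing tree of the positions of `S` has the shape of the insertion tree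
of the letters of `L`: the root of both is the last pair of `L`, and the pairs before and after it
in `S` are those of `L` with letter at most, respectively greater than, the one at the root. -/
theorem treeShape_decTree_of_sorted (L S : List (ℕ+ × ℕ+)) (hL : L.Pairwise (·.2 < ·.2))
    (hS : S.Pairwise (fun a b => a.1 < b.1 ∨ (a.1 = b.1 ∧ a.2 < b.2))) (hp : S.Perm L) :
    treeShape (decTree (S.map Prod.snd)) = treeShape (sylvP (L.map Prod.fst)) := by
  induction hn : L.length using Nat.strong_induction_on generalizing L S with
  | _ n ih =>
  rcases List.eq_nil_or_concat' L with rfl | ⟨L, ⟨x, p⟩, rfl⟩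
  · obtain rfl := hp.eq_nil
    simp [decTree_nil]
  · obtain ⟨S₁, S₂, rfl⟩ := List.append_of_mem (hp.symm.subset (by simp : (x, p) ∈ L ++ [(x, p)]))
    have hp' : (S₁ ++ S₂).Perm L := by
      refine (List.perm_cons (x, p)).1 ?_
      exact List.perm_middle.symm.trans (hp.trans (List.perm_append_singleton _ _))
    rw [List.pairwise_append] at hL hS
    obtain ⟨hL, -, hLp⟩ := hL
    obtain ⟨hS₁, hS₂, hS₁₂⟩ := hS
    rw [List.pairwise_cons] at hS₂
    have hpos {a : ℕ+ × ℕ+} (ha : a ∈ S₁ ++ S₂) : a.2 < p :=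
      hLp a (hp'.subset ha) (x, p) (by simp)
    have h₁ {a : ℕ+ × ℕ+} (ha : a ∈ S₁) : a.1 ≤ x := by
      rcases hS₁₂ a ha (x, p) (by simp) with h | h
      · exact h.le
      · exact h.1.le
    have h₂ {a : ℕ+ × ℕ+} (ha : a ∈ S₂) : x < a.1 := by
      rcases hS₂.1 a ha with h | h
      · exact h
      · exact absurd (hpos (List.mem_append_right _ ha)) h.2.not_gt
    have hq₁ : S₁.Perm (L.filter (·.1 ≤ x)) := by
      have := hp'.filter (fun a => decide (a.1 ≤ x))
      rwa [List.filter_append, List.filter_eq_self.2 (fun a ha => by simpa using h₁ ha),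
        List.filter_eq_nil_iff.2 (fun a ha => by simpa using h₂ ha), List.append_nil] at this
    have hq₂ : S₂.Perm (L.filter (x < ·.1)) := by
      have := hp'.filter (fun a => decide (x < a.1))
      rwa [List.filter_append, List.filter_eq_nil_iff.2 (fun a ha => by simpa using h₁ ha),
        List.filter_eq_self.2 (fun a ha => by simpa using h₂ ha), List.nil_append] at this
    have hlen : L.length < n := by simp [← hn]
    have e₁ := ih _ (lt_of_le_of_lt (List.length_filter_le (fun a => decide (a.1 ≤ x)) L) hlen)
      (L.filter (·.1 ≤ x)) S₁ (hL.filter _) hS₁ hq₁ rfl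
    have e₂ := ih _ (lt_of_le_of_lt (List.length_filter_le (fun a => decide (x < a.1)) L) hlen)
      (L.filter (x < ·.1)) S₂ (hL.filter _) hS₂.2 hq₂ rfl
    rw [List.map_append, List.map_cons, decTree_append_cons, List.map_append, List.map_singleton,
      sylvP_concat, List.filter_map, List.filter_map]
    · simp only [treeShape, BinaryTree.map, BinaryTree.node.injEq, true_and] at e₁ e₂ ⊢
      exact ⟨e₁, e₂⟩
    · intro a ha
      obtain ⟨b, hb, rfl⟩ := List.mem_map.1 ha
      exact hpos (List.mem_append_left _ hb)
    · intro a ha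
      obtain ⟨b, hb, rfl⟩ := List.mem_map.1 ha
      exact hpos (List.mem_append_right _ hb)

/-- The insertion tree of a word has the shape of the decreasing tree of the inverse of its
standardization. -/
theorem sylvShape_eq (u : Word) : sylvShape u = treeShape (sylvP u) := by
  let f : Fin u.length → ℕ+ × ℕ+ := fun p => (u.get p, Nat.succPNat p)
  have h := treeShape_decTree_of_sorted (List.ofFn f) (List.ofFn (f ∘ ⇑(stdPerm u)⁻¹)) ?_ ?_
    (Equiv.Perm.ofFn_comp_perm _ _)
  · simp only [List.map_ofFn] at h
    have hf : List.ofFn (Prod.fst ∘ f) = u := List.ofFn_get u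
    rw [hf] at h
    exact h
  · rw [List.pairwise_ofFn]
    intro i j hij
    exact Nat.succPNat_lt_succPNat.2 hij
  · rw [List.pairwise_ofFn]
    intro i j hij
    -- Ranks increase along the sorted list, so two positions out of order would contradict
    -- the monotonicity of `rank`.
    have hr (k) : rank u ((stdPerm u)⁻¹ k) = k :=
      congrArg Fin.val ((stdPerm u).apply_symm_apply k)
    set p := (stdPerm u)⁻¹ i with hp
    set q := (stdPerm u)⁻¹ j with hq
    have hlt : rank u p < rank u q := by
      rw [hp, hq, hr, hr]
      exact hij
    change u.get p < u.get q ∨ (u.get p = u.get q ∧ Nat.succPNat p < Nat.succPNat q)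
    rw [Nat.succPNat_lt_succPNat]
    rcases lt_trichotomy (u.get p) (u.get q) with h | h | h
    · exact Or.inl h
    · refine Or.inr ⟨h, ?_⟩
      rcases lt_trichotomy p q with h' | h' | h'
      · exact h'
      · exact absurd hlt (by rw [h']; exact lt_irrefl _)
      · exact absurd (rank_lt_rank u (Or.inr ⟨h.symm, h'⟩)) hlt.not_gt
    · exact absurd (rank_lt_rank u (Or.inl h)) hlt.not_gt

/-! ### Edges of the quasi-crystal graph -/

theorem not_pair_sublist_append_cons {a b c : ℕ+} {s t : Word}
    (hs : b ∉ s) (ht : a ∉ t) : ¬ [b, a].Sublist (s ++ c :: t) := by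
  intro h
  have hs' : [b, a].Sublist (c :: t) := by
    induction s with
    | nil => exact h
    | cons d s ih =>
      simp only [List.mem_cons, not_or] at hs
      rw [List.cons_append] at h
      cases h with
      | cons _ h => exact ih hs.2 h
      | cons_cons _ h => exact absurd rfl hs.1
  rw [List.cons_sublist_cons'] at hs'
  rcases hs' with h | ⟨-, h⟩
  · exact ht (h.subset (by simp))
  · exact ht (h.subset (by simp))

theorem pair_sublist_append {a b : ℕ+} {s t : Word} (hs : b ∈ s) (ht : a ∈ t) :
    [b, a].Sublist (s ++ t) :=
  (List.singleton_sublist.2 hs).append (List.singleton_sublist.2 ht)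

/-- The last occurrence of a letter in a word. -/
theorem eq_append_cons_notMem_of_mem {a : ℕ+} {u : Word} (h : a ∈ u) :
    ∃ s t : Word, u = s ++ a :: t ∧ a ∉ t := by
  obtain ⟨s, t, hst, hs⟩ := List.eq_append_cons_of_mem (List.mem_reverse.2 h)
  refine ⟨t.reverse, s.reverse, ?_, by simpa using hs⟩
  simpa using congrArg List.reverse hst

theorem replace_last {a b : ℕ+} {s t : Word} (ht : a ∉ t) :
    (((s ++ a :: t).reverse.replace a b).reverse) = s ++ b :: t := by
  simp [List.replace_append, ht]

theorem edge_iff {i : ℕ+} {u v : Word} :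
    Edge i u v ↔ ∃ s t, u = s ++ i :: t ∧ v = s ++ (i + 1) :: t ∧ i + 1 ∉ s ∧ i ∉ t := by
  unfold Edge lower
  constructor
  · intro h
    split_ifs at h with h₁ h₂
    obtain ⟨s, t, rfl, ht⟩ := eq_append_cons_notMem_of_mem h₂
    rw [replace_last ht, Option.some.injEq] at h
    exact ⟨s, t, rfl, h.symm, fun hs => h₁ (pair_sublist_append hs (by simp)), ht⟩
  · rintro ⟨s, t, rfl, rfl, hs, ht⟩
    rw [if_neg (not_pair_sublist_append_cons hs ht), if_pos (by simp),
      replace_last ht]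

theorem exists_edge_to_iff {i : ℕ+} {u : Word} :
    (∃ v, Edge i u v) ↔ i ∈ u ∧ ¬ [i + 1, i].Sublist u := by
  constructor
  · rintro ⟨v, h⟩
    obtain ⟨s, t, rfl, -, hs, ht⟩ := edge_iff.1 h
    exact ⟨by simp, not_pair_sublist_append_cons hs ht⟩
  · rintro ⟨h₁, h₂⟩
    exact ⟨_, by rw [Edge, lower, if_neg h₂, if_pos h₁]⟩

theorem exists_edge_from_iff {i : ℕ+} {v : Word} :
    (∃ u, Edge i u v) ↔ i + 1 ∈ v ∧ ¬ [i + 1, i].Sublist v := by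
  constructor
  · rintro ⟨u, h⟩
    obtain ⟨s, t, -, rfl, hs, ht⟩ := edge_iff.1 h
    exact ⟨by simp, not_pair_sublist_append_cons hs ht⟩
  · rintro ⟨h₁, h₂⟩
    obtain ⟨s, t, rfl, hs⟩ := List.eq_append_cons_of_mem h₁
    refine ⟨s ++ i :: t, edge_iff.2 ⟨s, t, rfl, rfl, hs, fun ht => h₂ ?_⟩⟩
    exact (pair_sublist_append (s := [i + 1]) (by simp) ht).trans (List.sublist_append_right _ _)

/-- An edge changes one letter of a word, so the contents of its ends determine each other. -/
theorem Edge.perm_iff {i : ℕ+} {u u' v v' : Word} (hu : Edge i u u') (hv : Edge i v v') :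
    u.Perm v ↔ u'.Perm v' := by
  obtain ⟨s, t, rfl, rfl, -, -⟩ := edge_iff.1 hu
  obtain ⟨s', t', rfl, rfl, -, -⟩ := edge_iff.1 hv
  have key (a : ℕ+) : (s ++ a :: t).Perm (s' ++ a :: t') ↔ (s ++ t).Perm (s' ++ t') := by
    rw [List.perm_middle.congr_left, List.perm_middle.congr_right, List.perm_cons]
  rw [key, key]

/-! ### Words with the same standardization -/

/-- Two words have the same standardization: they have the same length, and the letters at any two
positions compare in the same way, equal letters counting as increasing from left to right. -/
def SameStd (u v : Word) : Prop :=
  u.length = v.length ∧ ∀ (p q : ℕ) (_ : p < q) (hu : q < u.length) (hv : q < v.length),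
    u[p] ≤ u[q] ↔ v[p] ≤ v[q]

theorem SameStd.refl (u : Word) : SameStd u u := ⟨rfl, fun _ _ _ _ _ => Iff.rfl⟩

theorem SameStd.symm {u v : Word} (h : SameStd u v) : SameStd v u :=
  ⟨h.1.symm, fun p q hpq hv hu => (h.2 p q hpq hu hv).symm⟩

theorem SameStd.trans {u v w : Word} (h : SameStd u v) (h' : SameStd v w) : SameStd u w :=
  ⟨h.1.trans h'.1, fun p q hpq hu hw =>
    (h.2 p q hpq hu (h.1 ▸ hu)).trans (h'.2 p q hpq (h.1 ▸ hu) hw)⟩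

theorem sameStd_iff_exists {u v : Word} :
    SameStd u v ↔ ∃ L : List (ℕ+ × ℕ+), L.Pairwise (fun a b => a.1 ≤ b.1 ↔ a.2 ≤ b.2) ∧
      L.map Prod.fst = u ∧ L.map Prod.snd = v := by
  constructor
  · rintro ⟨hlen, h⟩
    refine ⟨u.zip v, ?_, List.map_fst_zip hlen.le, List.map_snd_zip hlen.ge⟩
    rw [List.pairwise_iff_getElem]
    intro p q hp hq hpq
    simp only [List.length_zip, lt_min_iff] at hq
    simpa using h p q hpq hq.1 hq.2
  · rintro ⟨L, hL, rfl, rfl⟩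
    refine ⟨by simp, fun p q hpq hu hv => ?_⟩
    rw [List.pairwise_iff_getElem] at hL
    simp only [List.length_map] at hu
    simpa using hL p q (hpq.trans hu) hu hpq

theorem Edge.sameStd {i : ℕ+} {u v : Word} (h : Edge i u v) : SameStd u v := by
  obtain ⟨s, t, rfl, rfl, hs, ht⟩ := edge_iff.1 h
  refine sameStd_iff_exists.2
    ⟨s.map (fun a => (a, a)) ++ (i, i + 1) :: t.map (fun a => (a, a)), ?_, ?_, ?_⟩
  · simp only [List.pairwise_append, List.pairwise_cons, List.pairwise_map, List.mem_map,
      List.mem_cons]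
    refine ⟨List.pairwise_of_forall (by simp), ⟨?_, List.pairwise_of_forall (by simp)⟩, ?_⟩
    · rintro _ ⟨a, ha, rfl⟩
      have hne : i ≠ a := fun h => ht (h ▸ ha)
      rw [PNat.add_one_le_iff, le_iff_lt_or_eq, or_iff_left hne]
    · rintro _ ⟨a, ha, rfl⟩ _ (rfl | ⟨b, hb, rfl⟩)
      · have hne : a ≠ i + 1 := fun h => hs (h ▸ ha)
        change a ≤ i ↔ a ≤ i + 1
        rw [← PNat.lt_add_one_iff, le_iff_lt_or_eq, or_iff_left hne]
      · rfl
  · simp [Function.comp_def]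
  · simp [Function.comp_def]

/-- The standardization is constant on connected components. -/
theorem Connected.sameStd {u v : Word} (h : Connected u v) : SameStd u v := by
  induction h with
  | rel _ _ h => exact h.elim fun _ h => h.sameStd
  | refl _ => exact SameStd.refl _
  | symm _ _ _ h => exact h.symm
  | trans _ _ _ _ _ h h' => exact h.trans h'

/-- Removing the last letter and splitting at its value uses only comparisons of letters that the
standardization records. -/
theorem SameStd.treeShape_eq {u v : Word} (h : SameStd u v) :
    treeShape (sylvP u) = treeShape (sylvP v) := by
  obtain ⟨L, hL, rfl, rfl⟩ := sameStd_iff_exists.1 h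
  clear h
  induction hn : L.length using Nat.strong_induction_on generalizing L with
  | _ n ih =>
  rcases List.eq_nil_or_concat' L with rfl | ⟨L, ⟨x, y⟩, rfl⟩
  · rfl
  · obtain ⟨hL, -, hxy⟩ := List.pairwise_append.1 hL
    replace hxy (a) (ha : a ∈ L) : a.1 ≤ x ↔ a.2 ≤ y := hxy a ha (x, y) (by simp)
    have hlen : L.length < n := by simp [← hn]
    have e₁ := ih _ (lt_of_le_of_lt (List.length_filter_le (fun a => decide (a.1 ≤ x)) L) hlen)
      (L.filter (·.1 ≤ x)) (hL.filter _) rfl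
    have e₂ := ih _ (lt_of_le_of_lt (List.length_filter_le (fun a => decide (x < a.1)) L) hlen)
      (L.filter (x < ·.1)) (hL.filter _) rfl
    have f₁ : L.filter (·.2 ≤ y) = L.filter (·.1 ≤ x) :=
      List.filter_congr fun a ha => by simp [hxy a ha]
    have f₂ : L.filter (y < ·.2) = L.filter (x < ·.1) :=
      List.filter_congr fun a ha => by simp [← not_le, hxy a ha]
    simp only [List.map_append, List.map_singleton, sylvP_concat, List.filter_map, treeShape,
      BinaryTree.map, BinaryTree.node.injEq, true_and]
    exact ⟨e₁.trans (congrArg (fun l => treeShape (sylvP (l.map Prod.snd))) f₁.symm),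
      e₂.trans (congrArg (fun l => treeShape (sylvP (l.map Prod.snd))) f₂.symm)⟩

/-- A word is determined by its standardization and its content. -/
theorem SameStd.eq_of_perm {u v : Word} (h : SameStd u v) (hp : u.Perm v) : u = v := by
  obtain ⟨L, hL, rfl, rfl⟩ := sameStd_iff_exists.1 h
  clear h
  induction L with
  | nil => rfl
  | cons a L ih =>
    obtain ⟨x, y⟩ := a
    rw [List.pairwise_cons] at hL
    simp only [List.map_cons] at hp ⊢
    -- The number of later letters at least the first letter is the same in both words.
    have hcount : (L.map Prod.fst).countP (x ≤ ·) = (L.map Prod.snd).countP (y ≤ ·) := by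
      rw [List.countP_map, List.countP_map]
      exact List.countP_congr fun a ha => by simpa using hL.1 a ha
    have hx := hp.countP_eq (x ≤ ·)
    have hy := hp.countP_eq (y ≤ ·)
    simp only [List.countP_cons, le_refl, decide_true, if_true] at hx hy
    have mono {a b : ℕ+} (hab : a < b) (w : Word) : w.countP (b ≤ ·) ≤ w.countP (a ≤ ·) :=
      List.countP_mono_left fun c _ hc => by
        simp only [decide_eq_true_eq] at hc ⊢
        exact hab.le.trans hc
    obtain rfl : x = y := by
      rcases lt_trichotomy x y with hlt | he | hlt
      · have := mono hlt (L.map Prod.fst)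
        rw [if_neg (by simpa using hlt)] at hy
        omega
      · exact he
      · have := mono hlt (L.map Prod.snd)
        rw [if_neg (by simpa using hlt)] at hx
        omega
    rw [ih hL.2 ((List.perm_cons x).1 hp)]

/-! ### Insertion equivalence and edges -/

theorem pair_sublist_concat_iff {i x : ℕ+} {w : Word} :
    [i + 1, i].Sublist (w ++ [x]) ↔ [i + 1, i].Sublist w ∨ (i = x ∧ i + 1 ∈ w) := by
  constructor
  · intro h
    obtain ⟨l₁, l₂, he, h₁, h₂⟩ := List.sublist_append_iff.1 h
    rcases List.sublist_singleton.1 h₂ with rfl | rfl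
    · rw [List.append_nil] at he
      exact Or.inl (he ▸ h₁)
    · obtain ⟨rfl, hx⟩ := List.append_inj' (s₁ := [i + 1]) (t₁ := [i]) he rfl
      exact Or.inr ⟨List.head_eq_of_cons_eq hx, List.singleton_sublist.1 h₁⟩
  · rintro (h | ⟨rfl, h⟩)
    · exact h.trans (List.sublist_append_left _ _)
    · exact pair_sublist_append h (by simp)

theorem pair_sublist_filter_iff {a b : ℕ+} {w : Word} {p : ℕ+ → Bool} (ha : p a) (hb : p b) :
    [b, a].Sublist (w.filter p) ↔ [b, a].Sublist w :=
  ⟨fun h => h.trans List.filter_sublist, fun h => by simpa [ha, hb] using h.filter p⟩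

/-- Whether `i + 1` occurs to the left of `i` can be read off from the insertion tree: both
letters lie in the same subtree of the root, unless the root is labelled `i`. -/
theorem pair_sublist_iff_of_sylvP_eq {u v : Word} (h : sylvP u = sylvP v) (i : ℕ+) :
    [i + 1, i].Sublist u ↔ [i + 1, i].Sublist v := by
  have hi : i < i + 1 := PNat.lt_add_right i 1
  induction h using sylvP_rec with
  | nil => rfl
  | concat u v x h₁ h₂ hl hr _ =>
    rw [pair_sublist_concat_iff, pair_sublist_concat_iff]
    rcases lt_trichotomy x i with hx | rfl | hx
    · simp only [hx.ne', false_and, or_false]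
      rwa [pair_sublist_filter_iff (by simpa using hx) (by simpa using hx.trans hi),
        pair_sublist_filter_iff (by simpa using hx) (by simpa using hx.trans hi)] at hr
    · have hmem : x + 1 ∈ u ↔ x + 1 ∈ v := by
        simpa [hi] using (perm_of_sylvP_eq h₂).mem_iff (a := x + 1)
      have hsub (w : Word) : [x + 1, x].Sublist w ∨ (x = x ∧ x + 1 ∈ w) ↔ x + 1 ∈ w :=
        ⟨fun h => h.elim (fun h => h.subset (by simp)) And.right, fun h => Or.inr ⟨rfl, h⟩⟩
      rw [hsub, hsub, hmem]
    · simp only [hx.ne, false_and, or_false]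
      have hx' := PNat.add_one_le_iff.2 hx
      rwa [pair_sublist_filter_iff (by simpa using hx.le) (by simpa using hx'),
        pair_sublist_filter_iff (by simpa using hx.le) (by simpa using hx')] at hl

/-- Edges out of a word are matched by edges out of any insertion-equivalent word. -/
theorem Edge.exists_to {i : ℕ+} {u u' v : Word} (h : Edge i u u') (huv : sylvP u = sylvP v) :
    ∃ v', Edge i v v' ∧ sylvP u' = sylvP v' := by
  have hp := perm_of_sylvP_eq huv
  obtain ⟨h₁, h₂⟩ := exists_edge_to_iff.1 ⟨u', h⟩
  obtain ⟨v', h'⟩ := exists_edge_to_iff.2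
    ⟨hp.subset h₁, (pair_sublist_iff_of_sylvP_eq huv i).not.1 h₂⟩
  refine ⟨v', h', sylvP_eq_of_treeShape_eq ?_ ((h.perm_iff h').1 hp)⟩
  rw [← h.sameStd.treeShape_eq, ← h'.sameStd.treeShape_eq, huv]

/-- Edges into a word are matched by edges into any insertion-equivalent word. -/
theorem Edge.exists_from {i : ℕ+} {u u' v' : Word} (h : Edge i u u')
    (huv : sylvP u' = sylvP v') : ∃ v, Edge i v v' ∧ sylvP u = sylvP v := by
  have hp := perm_of_sylvP_eq huv
  obtain ⟨h₁, h₂⟩ := exists_edge_from_iff.1 ⟨u, h⟩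
  obtain ⟨v, h'⟩ := exists_edge_from_iff.2
    ⟨hp.subset h₁, (pair_sublist_iff_of_sylvP_eq huv i).not.1 h₂⟩
  refine ⟨v, h', sylvP_eq_of_treeShape_eq ?_ ((h.perm_iff h').2 hp)⟩
  rw [h.sameStd.treeShape_eq, h'.sameStd.treeShape_eq, huv]

/-- Paths lift along insertion equivalence. -/
theorem Connected.exists_lift {w w' : Word} (h : Connected w w') {z : Word}
    (hz : sylvP w = sylvP z) : ∃ z', Connected z z' ∧ sylvP w' = sylvP z' := by
  have key : (∀ z, sylvP w = sylvP z → ∃ z', Connected z z' ∧ sylvP w' = sylvP z') ∧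
      (∀ z, sylvP w' = sylvP z → ∃ z', Connected z z' ∧ sylvP w = sylvP z') := by
    clear hz z
    induction h with
    | rel x y h =>
      obtain ⟨i, h⟩ := h
      refine ⟨fun z hz => ?_, fun z hz => ?_⟩
      · obtain ⟨z', hz', he⟩ := h.exists_to hz
        exact ⟨z', .rel _ _ ⟨i, hz'⟩, he⟩
      · obtain ⟨z', hz', he⟩ := h.exists_from hz
        exact ⟨z', .symm _ _ (.rel _ _ ⟨i, hz'⟩), he⟩
    | refl x => exact ⟨fun z hz => ⟨z, .refl _, hz⟩, fun z hz => ⟨z, .refl _, hz⟩⟩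
    | symm x y _ ih => exact ih.symm
    | trans x y t _ _ ih ih' =>
      refine ⟨fun z hz => ?_, fun z hz => ?_⟩
      · obtain ⟨z₁, hc, he⟩ := ih.1 z hz
        obtain ⟨z₂, hc', he'⟩ := ih'.1 z₁ he
        exact ⟨z₂, .trans _ _ _ hc hc', he'⟩
      · obtain ⟨z₁, hc, he⟩ := ih'.2 z hz
        obtain ⟨z₂, hc', he'⟩ := ih.2 z₁ he
        exact ⟨z₂, .trans _ _ _ hc hc', he'⟩
  exact key.1 z hz

/-- Each connected component meets each insertion class at most once. -/
theorem Connected.eq_of_sylvP_eq {u v : Word} (h : Connected u v) (he : sylvP u = sylvP v) :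
    u = v :=
  h.sameStd.eq_of_perm (perm_of_sylvP_eq he)

/-- Insertion-equivalent words correspond under the isomorphism that sends each vertex of one
component to the insertion-equivalent vertex of the other. -/
theorem crystalSylv_of_sylvP_eq {u v : Word} (h : sylvP u = sylvP v) : CrystalSylv u v := by
  have lift {u v : Word} (h : sylvP u = sylvP v) (w : Component u) :
      ∃ z : Component v, sylvP w.1 = sylvP z.1 := by
    obtain ⟨z, hz, he⟩ := Connected.exists_lift w.2 h
    exact ⟨⟨z, hz⟩, he⟩
  have uniq {u : Word} {w z : Component u} (he : sylvP w.1 = sylvP z.1) : w = z :=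
    Subtype.ext (Connected.eq_of_sylvP_eq (.trans _ _ _ (.symm _ _ w.2) z.2) he)
  choose f hf using lift h
  choose g hg using lift h.symm
  refine ⟨⟨⟨f, g, fun w => uniq ((hf w).trans (hg _)).symm,
    fun z => uniq ((hg z).trans (hf _)).symm⟩, fun i x y => ⟨fun e => ?_, fun e => ?_⟩⟩, ?_, ?_⟩
  · obtain ⟨z, hz, he⟩ := e.exists_to (hf x)
    have hc : Connected v z := .trans _ _ _ (f x).2 (.rel _ _ ⟨i, hz⟩)
    change Edge i (f x).1 (f y).1
    rwa [show f y = ⟨z, hc⟩ from uniq ((hf y).symm.trans he)]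
  · obtain ⟨z, hz, he⟩ := e.exists_to (hf x).symm
    have hc : Connected u z := .trans _ _ _ x.2 (.rel _ _ ⟨i, hz⟩)
    rwa [show y = ⟨z, hc⟩ from uniq ((hf y).trans he)]
  · intro w
    rw [sylvShape_eq, sylvShape_eq]
    exact congrArg treeShape (hf w).symm
  · exact uniq ((hf _).symm.trans h)

/-! ### Shape-preserving isomorphisms preserve the insertion tree -/

/-- A word over the alphabet `{m < m + 1 < ⋯}` in which every letter `i + 1 > m` occurs to the left
of some letter `i`. For `m = 1` these are the vertices of the quasi-crystal graph without incoming
edges. -/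
def IsSourceFrom (m : ℕ+) (u : Word) : Prop :=
  (∀ a ∈ u, m ≤ a) ∧ ∀ i, m ≤ i → i + 1 ∈ u → [i + 1, i].Sublist u

theorem IsSourceFrom.pair_sublist {m i x : ℕ+} {u : Word} (h : IsSourceFrom m (u ++ [x]))
    (hm : m ≤ i) (hi : i + 1 ∈ u ++ [x]) (hx : i ≠ x) : [i + 1, i].Sublist u :=
  (pair_sublist_concat_iff.1 (h.2 i hm hi)).resolve_right fun h => hx h.1

theorem IsSourceFrom.filter_le {m x : ℕ+} {u : Word} (h : IsSourceFrom m (u ++ [x])) :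
    IsSourceFrom m (u.filter (· ≤ x)) := by
  refine ⟨fun a ha => h.1 a (List.mem_append_left _ (List.mem_of_mem_filter ha)),
    fun i hm hi => ?_⟩
  simp only [List.mem_filter, decide_eq_true_eq] at hi
  have hx : i < x := PNat.add_one_le_iff.1 hi.2
  rw [pair_sublist_filter_iff (by simpa using hx.le) (by simpa using hi.2)]
  exact h.pair_sublist hm (List.mem_append_left _ hi.1) hx.ne

theorem IsSourceFrom.filter_lt {m x : ℕ+} {u : Word} (h : IsSourceFrom m (u ++ [x])) :
    IsSourceFrom (x + 1) (u.filter (x < ·)) := by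
  refine ⟨fun a ha => ?_, fun i hm hi => ?_⟩
  · simp only [List.mem_filter, decide_eq_true_eq] at ha
    exact PNat.add_one_le_iff.2 ha.2
  · simp only [List.mem_filter, decide_eq_true_eq] at hi
    have hx : x < i := PNat.add_one_le_iff.1 hm
    rw [pair_sublist_filter_iff (by simpa using hx) (by simpa using hi.2)]
    exact h.pair_sublist ((h.1 x (by simp)).trans hx.le) (List.mem_append_left _ hi.1) hx.ne'

/-- The root label is `m` or occurs in the left subtree. -/
theorem IsSourceFrom.eq_or_mem {m x : ℕ+} {u : Word} (h : IsSourceFrom m (u ++ [x])) :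
    x = m ∨ x ∈ u := by
  refine or_iff_not_imp_left.2 fun hne => ?_
  have hlt : m < x := lt_of_le_of_ne (h.1 x (by simp)) (Ne.symm hne)
  obtain ⟨i, rfl⟩ := PNat.exists_eq_succ_of_ne_one (n := x) (one_le.trans_lt hlt).ne'
  exact (h.pair_sublist (PNat.lt_add_one_iff.1 hlt) (by simp)
    (PNat.lt_add_right i 1).ne).subset (by simp)

/-- The shape of the insertion tree of a source forces its labels: the root label is `m` or the
largest label of the left subtree, and the labels of the right subtree start right after it. -/
theorem IsSourceFrom.sylvP_eq {u v : Word} {m : ℕ+} (hu : IsSourceFrom m u)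
    (hv : IsSourceFrom m v) (h : treeShape (sylvP u) = treeShape (sylvP v)) :
    sylvP u = sylvP v := by
  induction h using treeShape_sylvP_rec generalizing m with
  | nil => rfl
  | concat u v x y _ _ hl hr _ =>
    have el := hl hu.filter_le hv.filter_le
    have root_le {u v : Word} {x y : ℕ+} (hu : IsSourceFrom m (u ++ [x]))
        (hv : IsSourceFrom m (v ++ [y]))
        (el : sylvP (u.filter (· ≤ x)) = sylvP (v.filter (· ≤ y))) : x ≤ y := by
      rcases hu.eq_or_mem with rfl | hx
      · exact hv.1 y (by simp)
      · have := (perm_of_sylvP_eq el).subset (List.mem_filter.2 ⟨hx, by simp⟩)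
        simpa using (List.mem_filter.1 this).2
    obtain rfl : x = y := le_antisymm (root_le hu hv el) (root_le hv hu el.symm)
    rw [sylvP_concat, sylvP_concat, el, hr hu.filter_lt hv.filter_lt]

/-- Every shape-preserving isomorphism maps each vertex to an insertion-equivalent one. -/
theorem sylvP_toEquiv_eq {u v : Word} (θ : ComponentIso u v)
    (hθ : ShapePreserving sylvShape θ) (w : Component u) :
    sylvP (θ.toEquiv w).1 = sylvP w.1 := by
  induction hn : (w.1.map PNat.val).sum using Nat.strong_induction_on generalizing w with
  | _ n ih =>
  have hsh : treeShape (sylvP (θ.toEquiv w).1) = treeShape (sylvP w.1) := by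
    rw [← sylvShape_eq, ← sylvShape_eq]
    exact hθ w
  by_cases hsrc : ∃ i x, Edge i x w.1
  · obtain ⟨i, x, hx⟩ := hsrc
    have hc : Connected u x := .trans _ _ _ w.2 (.symm _ _ (.rel _ _ ⟨i, hx⟩))
    have hx' := (θ.edge_iff i ⟨x, hc⟩ w).1 hx
    refine sylvP_eq_of_treeShape_eq hsh ((hx'.perm_iff hx).1 (perm_of_sylvP_eq ?_))
    refine ih _ ?_ _ rfl
    obtain ⟨s, t, rfl, hw, -, -⟩ := edge_iff.1 hx
    rw [← hn, hw]
    simp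
  · have hsrc' : ¬ ∃ i x, Edge i x (θ.toEquiv w).1 := by
      rintro ⟨i, x, hx⟩
      have hc : Connected v x :=
        .trans _ _ _ (θ.toEquiv w).2 (.symm _ _ (.rel _ _ ⟨i, hx⟩))
      refine hsrc ⟨i, (θ.toEquiv.symm ⟨x, hc⟩).1, (θ.edge_iff i _ w).2 ?_⟩
      have he : θ.toEquiv (θ.toEquiv.symm ⟨x, hc⟩) = ⟨x, hc⟩ := θ.toEquiv.apply_symm_apply _
      rwa [he]
    have key {w : Word} (h : ¬ ∃ i x, Edge i x w) (i : ℕ+) (hi : i + 1 ∈ w) :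
        [i + 1, i].Sublist w := by
      by_contra hs
      exact h ⟨i, exists_edge_from_iff.2 ⟨hi, hs⟩⟩
    exact IsSourceFrom.sylvP_eq (m := 1) ⟨fun _ _ => one_le, fun i _ => key hsrc' i⟩
      ⟨fun _ _ => one_le, fun i _ => key hsrc i⟩ hsh

theorem crystalSylv_iff_sylvP_eq {u v : Word} : CrystalSylv u v ↔ sylvP u = sylvP v := by
  refine ⟨?_, crystalSylv_of_sylvP_eq⟩
  rintro ⟨θ, hθ, hbase⟩
  have h := sylvP_toEquiv_eq θ hθ (Component.base u)
  rw [hbase] at h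
  exact h.symm

end SylvQC

/-- The relations `∼_sylv` and `≡_sylv` are congruences on the free monoid over `{1 < 2 < ⋯}`,
and they coincide. -/
theorem mainTheorem1 :
    ∃ c d : Con (FreeMonoid ℕ+),
      (∀ u v : FreeMonoid ℕ+, c u v ↔ SylvQC.CrystalSylv u.toList v.toList) ∧
      (∀ u v : FreeMonoid ℕ+, d u v ↔ SylvQC.InsertionSylv u.toList v.toList) ∧
      c = d :=
  ⟨SylvQC.insertionCon, SylvQC.insertionCon,
    fun _ _ => SylvQC.crystalSylv_iff_sylvP_eq.symm, fun _ _ => Iff.rfl, rfl⟩
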